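/- Let $d \ge 2$ be an integer and let $b \ge 0$ be such that $bd$ is an integer. Let $\mathbf{x}$ be uniformly distributed on the unit sphere $\mathbb{S}^{d-1} \subset \mathbb{R}^d$, let $Q : \mathbb{R}^d \to \{0,1\}^{bd}$ be any fixed (deterministic, Borel measurable) quantization map, and let $Q^{-1} : \{0,1\}^{bd} \to \mathbb{R}^d$ be any dequantization map (not necessarily an inverse of $Q$). Then $$\mathbb{E}_{\mathbf{x}}\left[\|\mathbf{x} - Q^{-1}(Q(\mathbf{x}))\|_2^2\right] \ge c_d \left(\tfrac14\right)^{\frac{bd}{d-1}},$$ where $$c_d := \frac{d-1}{2\pi e}\left(\frac{\pi^{d/2}}{\Gamma(d/2)}\right)^{2/(d-1)} \exp\left(\frac{\psi(1/2)-\psi(d/2)}{d-1}\right)$$ and $\psi(t) = \Gamma'(t)/\Gamma(t)$ is the digamma function. The expected value on the left is finite. Moreover $c_d \to 1$ as $d \to \infty$, and $c_d = 0.936,\ 0.991,\ 0.999$ for $d = 100,\ 1000,\ 10000$, respectively, with an absolute error less than $0.0005$ in each case. -/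

import Mathlib

open MeasureTheory ProbabilityTheory Filter Topology

noncomputable section

/-- The uniform probability measure on the unit sphere `S^{d-1}` of Euclidean space `ℝ^d` (`d ≥ 1`),
as a measure on `ℝ^d`: the surface measure of the sphere, divided by its total mass. -/
def sphereUniform (d : ℕ) : Measure (EuclideanSpace ℝ (Fin d)) :=
  (((volume : Measure (EuclideanSpace ℝ (Fin d))).toSphere Set.univ)⁻¹ •
    (volume : Measure (EuclideanSpace ℝ (Fin d))).toSphere).map Subtype.val

/-- The real digamma function `ψ(t) = Γ'(t) / Γ(t)`. -/
def realDigamma (t : ℝ) : ℝ := logDeriv Real.Gamma t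

/-- The constant
`c_d = (d-1)/(2πe) * (π^{d/2} / Γ(d/2))^{2/(d-1)} * exp((ψ(1/2) - ψ(d/2)) / (d-1))`, for `d ≥ 2`. -/
def shannonConst (d : ℕ) : ℝ :=
  ((d : ℝ) - 1) / (2 * Real.pi * Real.exp 1) *
    (Real.pi ^ ((d : ℝ) / 2) / Real.Gamma ((d : ℝ) / 2)) ^ ((2 : ℝ) / ((d : ℝ) - 1)) *
    Real.exp ((realDigamma (1 / 2) - realDigamma ((d : ℝ) / 2)) / ((d : ℝ) - 1))

end

/-!
Proof of the Shannon lower bound for quantizers of the uniform distribution on the unit sphere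
`S^n` of `ℝ^{n+1}`, together with the asymptotics of its constant.

Let `A` be the area of the sphere and `u` the projection of a uniform point `x` to the hyperplane
of the last `n` coordinates (all but `x₀`). The projection has density `2 / (A * |x₀|)` on the unit
ball, and projecting does not increase the quantization error. For a code with `M` points let `W`
be the sum of the `M` Gaussian densities of variance `s` centred at the projected code points. As
`W` has integral `M`, the expectation of `Z = (A / 2) * |x₀| * W(u)` is at most `M`, so by Jensen's
inequality `E log Z ≤ log M`. On the other hand `W` is at least the term of the code point that `x`
is mapped to, so that

`log (A / 2) + E log |x₀| - (n / 2) * log (2 π s) - D / (2 s) ≤ log M`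

where `D` is the mean squared error (`gibbs_sphere`). The choice of `s` that makes this tight gives
`shannon_lower_bound_sphere`. No entropy or mutual information is needed.

Two facts on the sphere enter. First, `E Z ≤ M` is the upper half of the formula for the projected
surface measure (`lintegral_sphere_proj_le`). It follows from polar coordinates and Fubini applied
to thin shells: on a vertical line, `|x₀| / ‖x‖` is the derivative of the radius, so a line meets a
shell of thickness `ε` in weighted length at most `2 ε`. Second,
`E log |x₀| = (ψ(1/2) - ψ((n+1)/2)) / 2` (`integral_toSphere_log_coord`): integrate
`exp (-‖x‖²) * log |x₀|` over `ℝ^{n+1}` in product coordinates and in polar coordinates, and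
recognize derivatives of `Γ` in the radial integrals.

For the constant, `shannonConst_eq` cancels the powers of `π` and leaves `(d - 1) / d` times the
exponential of `O(log d) / (d - 1)`, with Stirling's formula and `log (x - 1) ≤ ψ(x) ≤ log x`
providing the estimates. In even dimension `ψ(d / 2)` is a harmonic number minus Euler's constant,
and the three numerical values follow from `shannonConst_even`.
-/

/-! ### Splitting off a coordinate, and polar coordinates -/

/-- Splitting a vector of `ℝ^{n+1}` into its zeroth coordinate and the vector of the other `n`
coordinates, as a measurable equivalence between Euclidean spaces. -/
noncomputable def splitFirst (n : ℕ) :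
    EuclideanSpace ℝ (Fin (n + 1)) ≃ᵐ ℝ × EuclideanSpace ℝ (Fin n) :=
  (MeasurableEquiv.toLp 2 (Fin (n + 1) → ℝ)).symm.trans
    ((MeasurableEquiv.piFinSuccAbove (fun _ => ℝ) 0).trans
      ((MeasurableEquiv.refl ℝ).prodCongr (MeasurableEquiv.toLp 2 (Fin n → ℝ))))

lemma splitFirst_fst (n : ℕ) (x : EuclideanSpace ℝ (Fin (n + 1))) :
    (splitFirst n x).1 = x 0 := rfl

lemma splitFirst_snd_apply (n : ℕ) (x : EuclideanSpace ℝ (Fin (n + 1))) (i : Fin n) :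
    (splitFirst n x).2 i = x i.succ := rfl

lemma measurePreserving_splitFirst (n : ℕ) : MeasurePreserving (splitFirst n) := by
  refine (EuclideanSpace.volume_preserving_symm_measurableEquiv_toLp _).trans ?_
  refine (volume_preserving_piFinSuccAbove (fun _ => ℝ) 0).trans ?_
  exact (MeasurePreserving.id volume).prod (PiLp.volume_preserving_toLp (Fin n))

lemma splitFirst_sub (n : ℕ) (x y : EuclideanSpace ℝ (Fin (n + 1))) :
    splitFirst n (x - y) = splitFirst n x - splitFirst n y := rfl

lemma norm_sq_eq_splitFirst (n : ℕ) (x : EuclideanSpace ℝ (Fin (n + 1))) :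
    ‖x‖ ^ 2 = (splitFirst n x).1 ^ 2 + ‖(splitFirst n x).2‖ ^ 2 := by
  simp [EuclideanSpace.norm_sq_eq, Fin.sum_univ_succ, splitFirst_fst, splitFirst_snd_apply]

/-- Polar coordinates: `(θ, r) ↦ r • θ` carries the product of the surface measure and of
`r^{dim - 1} dr` to Lebesgue measure. -/
lemma measurePreserving_polar {E : Type*} [NormedAddCommGroup E] [NormedSpace ℝ E]
    [MeasurableSpace E] [BorelSpace E] [FiniteDimensional ℝ E] [Nontrivial E]
    (μ : Measure E) [μ.IsAddHaarMeasure] :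
    MeasurePreserving (fun p : Metric.sphere (0 : E) 1 × Set.Ioi (0 : ℝ) => p.2.1 • p.1.1)
      (μ.toSphere.prod (Measure.volumeIoiPow (Module.finrank ℝ E - 1))) μ := by
  have h1 := μ.measurePreserving_homeomorphUnitSphereProd
  have h2 := h1.symm (homeomorphUnitSphereProd E).toMeasurableEquiv
  have h3 : MeasurePreserving (Subtype.val : ({(0 : E)}ᶜ : Set E) → E)
      (μ.comap Subtype.val) μ := by
    have := measurePreserving_subtype_coe (μa := μ) (measurableSet_singleton (0 : E)).compl
    rwa [restrict_compl_singleton] at this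
  exact h3.comp h2

lemma measurableEmbedding_polar {E : Type*} [NormedAddCommGroup E] [NormedSpace ℝ E]
    [MeasurableSpace E] [BorelSpace E] [FiniteDimensional ℝ E] :
    MeasurableEmbedding
      (fun p : Metric.sphere (0 : E) 1 × Set.Ioi (0 : ℝ) => p.2.1 • p.1.1) :=
  (MeasurableEmbedding.subtype_coe (measurableSet_singleton (0 : E)).compl).comp
    (homeomorphUnitSphereProd E).symm.measurableEmbedding

lemma lintegral_volumeIoiPow (n : ℕ) (f : ℝ → ENNReal) (hf : Measurable f) :
    ∫⁻ r, f r.1 ∂(Measure.volumeIoiPow n) =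
      ∫⁻ r in Set.Ioi (0 : ℝ), ENNReal.ofReal (r ^ n) * f r := by
  rw [Measure.volumeIoiPow, lintegral_withDensity_eq_lintegral_mul _ (by fun_prop) (by fun_prop)]
  exact lintegral_subtype_comap measurableSet_Ioi (fun r : ℝ => ENNReal.ofReal (r ^ n) * f r)

lemma integral_volumeIoiPow (n : ℕ) (f : ℝ → ℝ) :
    ∫ r, f r.1 ∂(Measure.volumeIoiPow n) = ∫ r in Set.Ioi (0 : ℝ), r ^ n * f r := by
  simp only [Measure.volumeIoiPow, ENNReal.ofReal]
  rw [integral_withDensity_eq_integral_smul (by fun_prop),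
    integral_subtype_comap measurableSet_Ioi fun a : ℝ ↦ Real.toNNReal (a ^ n) • f a]
  refine setIntegral_congr_fun measurableSet_Ioi fun x hx ↦ ?_
  simp only [NNReal.smul_def, Real.coe_toNNReal _ (pow_nonneg (Set.mem_Ioi.1 hx).le n), smul_eq_mul]

lemma integrable_volumeIoiPow_iff (n : ℕ) (f : ℝ → ℝ) :
    Integrable (fun r : Set.Ioi (0 : ℝ) => f r.1) (Measure.volumeIoiPow n) ↔
      IntegrableOn (fun r => r ^ n * f r) (Set.Ioi 0) := by
  rw [integrableOn_iff_comap_subtypeVal measurableSet_Ioi, Measure.volumeIoiPow,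
    integrable_withDensity_iff_integrable_smul' (by fun_prop) (by simp)]
  refine integrable_congr (.of_forall ?_)
  rintro ⟨x, hx : 0 < x⟩
  simp (disch := positivity) [ENNReal.toReal_ofReal]

/-- For fixed `u`, the radius `t ↦ √(t² + u²)` has derivative `t / √(t² + u²)`, so that weighting
a half line with it amounts to integrating over radii. -/
lemma setLIntegral_radius_le (u : ℝ) (ψ : ℝ → ENNReal) :
    ∫⁻ t in Set.Ioi (0 : ℝ), ENNReal.ofReal (|t| / √(t ^ 2 + u ^ 2)) * ψ (√(t ^ 2 + u ^ 2)) ≤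
      ∫⁻ r, ψ r := by
  have hder : ∀ t ∈ Set.Ioi (0 : ℝ), HasDerivWithinAt (fun t => √(t ^ 2 + u ^ 2))
      (t / √(t ^ 2 + u ^ 2)) (Set.Ioi 0) t := by
    intro t ht
    have hpos : 0 < t ^ 2 + u ^ 2 := by have := Set.mem_Ioi.1 ht; positivity
    have h := (((hasDerivAt_pow 2 t).add_const (u ^ 2)).sqrt hpos.ne').hasDerivWithinAt
      (s := Set.Ioi 0)
    refine h.congr_deriv ?_
    rw [Nat.cast_ofNat, Nat.add_one_sub_one, pow_one, mul_div_mul_left _ _ (two_ne_zero' ℝ)]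
  have hinj : Set.InjOn (fun t => √(t ^ 2 + u ^ 2)) (Set.Ioi 0) := by
    intro a ha b hb hab
    have h : a ^ 2 + u ^ 2 = b ^ 2 + u ^ 2 :=
      (Real.sqrt_inj (by positivity) (by positivity)).1 hab
    exact (pow_left_inj₀ (Set.mem_Ioi.1 ha).le (Set.mem_Ioi.1 hb).le two_ne_zero).1 (by linarith)
  have h := lintegral_image_eq_lintegral_abs_deriv_mul measurableSet_Ioi hder hinj ψ
  calc _ = _ := by
        rw [h]
        refine setLIntegral_congr_fun measurableSet_Ioi fun t ht => ?_
        simp only [abs_div, abs_of_nonneg (Real.sqrt_nonneg _)]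
    _ ≤ _ := setLIntegral_le_lintegral _ _

lemma lintegral_radius_le (u : ℝ) (ψ : ℝ → ENNReal) :
    ∫⁻ t : ℝ, ENNReal.ofReal (|t| / √(t ^ 2 + u ^ 2)) * ψ (√(t ^ 2 + u ^ 2)) ≤
      2 * ∫⁻ r, ψ r := by
  set F : ℝ → ENNReal :=
    fun t => ENNReal.ofReal (|t| / √(t ^ 2 + u ^ 2)) * ψ (√(t ^ 2 + u ^ 2)) with hF
  have hneg : ∫⁻ t in Set.Iio (0 : ℝ), F t = ∫⁻ t in Set.Ioi (0 : ℝ), F t := by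
    have h := (Measure.measurePreserving_neg (volume : Measure ℝ)).setLIntegral_comp_emb
      (MeasurableEquiv.neg ℝ).measurableEmbedding F (Set.Ioi 0)
    simpa [hF] using h.symm
  rw [two_mul, ← lintegral_add_compl F (measurableSet_Ioi (a := (0 : ℝ))), Set.compl_Ioi,
    ← setLIntegral_congr (Iio_ae_eq_Iic (a := (0 : ℝ))), hneg]
  exact add_le_add (setLIntegral_radius_le u ψ) (setLIntegral_radius_le u ψ)

/-! ### The projection of the surface measure to a hyperplane -/

lemma finrank_euclidean_sub_one (n : ℕ) :
    Module.finrank ℝ (EuclideanSpace ℝ (Fin (n + 1))) - 1 = n := by simp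

lemma continuous_splitFirst_snd (n : ℕ) :
    Continuous fun x : EuclideanSpace ℝ (Fin (n + 1)) => (splitFirst n x).2 := by
  refine (PiLp.continuous_toLp 2 _).comp (continuous_pi fun i => ?_)
  change Continuous fun x : EuclideanSpace ℝ (Fin (n + 1)) => x i.succ
  fun_prop

lemma measurable_sphere_integrand (n : ℕ) {G : EuclideanSpace ℝ (Fin n) → ENNReal}
    (hG : Measurable G) :
    Measurable (Function.uncurry fun (r : ℝ)
      (θ : Metric.sphere (0 : EuclideanSpace ℝ (Fin (n + 1))) 1) =>
        G (r • (splitFirst n θ.1).2) * ENNReal.ofReal |θ.1 0|) := by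
  have h1 := (continuous_splitFirst_snd n).measurable
  refine (hG.comp (measurable_fst.smul
    (h1.comp (measurable_subtype_coe.comp measurable_snd)))).mul ?_
  have h0 : Measurable fun x : EuclideanSpace ℝ (Fin (n + 1)) => ENNReal.ofReal |x 0| := by
    fun_prop
  exact h0.comp (measurable_subtype_coe.comp measurable_snd)

lemma measurable_lintegral_sphere (n : ℕ) {G : EuclideanSpace ℝ (Fin n) → ENNReal}
    (hG : Measurable G) :
    Measurable fun r : ℝ => ∫⁻ θ : Metric.sphere (0 : EuclideanSpace ℝ (Fin (n + 1))) 1,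
        G (r • (splitFirst n θ.1).2) * ENNReal.ofReal |θ.1 0|
        ∂(volume : Measure (EuclideanSpace ℝ (Fin (n + 1)))).toSphere :=
  (measurable_sphere_integrand n hG).lintegral_prod_right

/-- The bound on the projected surface measure, on average over the radius: vertical lines meet a shell
of thickness `ε`, weighted by `|x₀| / ‖x‖`, in measure at most `2 * ε`. -/
lemma lintegral_shell_le (n : ℕ) {G : EuclideanSpace ℝ (Fin n) → ENNReal} (hG : Measurable G)
    {ψ : ℝ → ENNReal} (hψ : Measurable ψ) :
    ∫⁻ r in Set.Ioi (0 : ℝ), ψ r * (ENNReal.ofReal (r ^ n) *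
        ∫⁻ θ : Metric.sphere (0 : EuclideanSpace ℝ (Fin (n + 1))) 1,
          G (r • (splitFirst n θ.1).2) * ENNReal.ofReal |θ.1 0|
          ∂(volume : Measure (EuclideanSpace ℝ (Fin (n + 1)))).toSphere) ≤
      2 * (∫⁻ r, ψ r) * ∫⁻ u, G u := by
  set F : EuclideanSpace ℝ (Fin (n + 1)) → ENNReal := fun x =>
    G (splitFirst n x).2 * (ENNReal.ofReal (|x 0| / ‖x‖) * ψ ‖x‖) with hF
  have hFm : Measurable F := by
    have h0 : Measurable fun x : EuclideanSpace ℝ (Fin (n + 1)) => x 0 := by fun_prop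
    have h1 : Measurable fun x : EuclideanSpace ℝ (Fin (n + 1)) => (splitFirst n x).2 :=
      (splitFirst n).measurable.snd
    have h2 : Measurable fun x : EuclideanSpace ℝ (Fin (n + 1)) => |x 0| / ‖x‖ :=
      (measurable_norm.comp h0).div measurable_norm
    exact (hG.comp h1).mul (h2.ennreal_ofReal.mul (hψ.comp measurable_norm))
  have hpolar := (measurePreserving_polar
    (volume : Measure (EuclideanSpace ℝ (Fin (n + 1))))).lintegral_comp hFm
  rw [finrank_euclidean_sub_one, lintegral_prod_symm _ (by fun_prop)] at hpolar
  have hleft : ∫⁻ x, F x = ∫⁻ r in Set.Ioi (0 : ℝ), ψ r * (ENNReal.ofReal (r ^ n) *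
        ∫⁻ θ : Metric.sphere (0 : EuclideanSpace ℝ (Fin (n + 1))) 1,
          G (r • (splitFirst n θ.1).2) * ENNReal.ofReal |θ.1 0|
          ∂(volume : Measure (EuclideanSpace ℝ (Fin (n + 1)))).toSphere) := by
    rw [← hpolar]
    have hm : Measurable fun r : ℝ => ψ r * ∫⁻ θ : Metric.sphere
        (0 : EuclideanSpace ℝ (Fin (n + 1))) 1,
          G (r • (splitFirst n θ.1).2) * ENNReal.ofReal |θ.1 0|
          ∂(volume : Measure (EuclideanSpace ℝ (Fin (n + 1)))).toSphere :=
      hψ.mul (measurable_lintegral_sphere n hG)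
    calc _ = ∫⁻ r : Set.Ioi (0 : ℝ), (ψ r.1 * ∫⁻ θ : Metric.sphere
          (0 : EuclideanSpace ℝ (Fin (n + 1))) 1,
          G (r.1 • (splitFirst n θ.1).2) * ENNReal.ofReal |θ.1 0|
          ∂(volume : Measure (EuclideanSpace ℝ (Fin (n + 1)))).toSphere)
          ∂(Measure.volumeIoiPow n) := by
          refine lintegral_congr fun r => ?_
          rw [← lintegral_const_mul _ (measurable_sphere_integrand n hG).of_uncurry_left]
          refine lintegral_congr fun θ => ?_
          have hr : 0 < r.1 := r.2
          have hθ : ‖θ.1‖ = 1 := by simp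
          have h1 : |r.1 * θ.1 0| / r.1 = |θ.1 0| := by
            rw [abs_mul, abs_of_pos hr, mul_div_cancel_left₀ _ hr.ne']
          have h2 : (splitFirst n (r.1 • θ.1)).2 = r.1 • (splitFirst n θ.1).2 := rfl
          simp only [hF, h2, norm_smul, Real.norm_eq_abs, abs_of_pos hr, hθ, mul_one,
            PiLp.smul_apply, smul_eq_mul, h1]
          ring
      _ = _ := by
          rw [lintegral_volumeIoiPow n _ hm]
          refine lintegral_congr fun r => ?_
          ring
  have hfib : ∫⁻ x, F x ≤ 2 * (∫⁻ r, ψ r) * ∫⁻ u, G u := by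
    rw [← (measurePreserving_splitFirst n).symm.lintegral_comp hFm, Measure.volume_eq_prod,
      lintegral_prod_symm _ (by fun_prop), ← lintegral_const_mul _ hG]
    refine lintegral_mono fun u => ?_
    have hval : ∀ t : ℝ, F ((splitFirst n).symm (t, u)) =
        G u * (ENNReal.ofReal (|t| / √(t ^ 2 + ‖u‖ ^ 2)) * ψ (√(t ^ 2 + ‖u‖ ^ 2))) := by
      intro t
      have hs : splitFirst n ((splitFirst n).symm (t, u)) = (t, u) :=
        (splitFirst n).apply_symm_apply _
      have h0 : ((splitFirst n).symm (t, u)) 0 = t := by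
        rw [← splitFirst_fst, hs]
      have hnorm : ‖(splitFirst n).symm (t, u)‖ = √(t ^ 2 + ‖u‖ ^ 2) := by
        rw [← Real.sqrt_sq (norm_nonneg ((splitFirst n).symm (t, u))), norm_sq_eq_splitFirst, hs]
      simp only [hF, hs, h0, hnorm]
    simp only [hval]
    rw [lintegral_const_mul _ (by fun_prop), mul_comm]
    gcongr
    exact lintegral_radius_le _ ψ
  exact hleft ▸ hfib

/-- The orthogonal projection of the sphere onto the equatorial hyperplane: each point of the ball
has two preimages, and the surface element is `du / |x₀|`. Only the resulting upper bound is
needed. -/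
lemma lintegral_sphere_proj_le (n : ℕ) {G : EuclideanSpace ℝ (Fin n) → ENNReal}
    (hG : Continuous G) :
    ∫⁻ θ : Metric.sphere (0 : EuclideanSpace ℝ (Fin (n + 1))) 1,
        G (splitFirst n θ.1).2 * ENNReal.ofReal |θ.1 0|
        ∂(volume : Measure (EuclideanSpace ℝ (Fin (n + 1)))).toSphere ≤
      2 * ∫⁻ u, G u := by
  set σ := (volume : Measure (EuclideanSpace ℝ (Fin (n + 1)))).toSphere
  set h : ℝ → ENNReal := fun r => ∫⁻ θ : Metric.sphere (0 : EuclideanSpace ℝ (Fin (n + 1))) 1,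
        G (r • (splitFirst n θ.1).2) * ENNReal.ofReal |θ.1 0| ∂σ with hh
  -- averaging the shell bound finds radii arbitrarily close to `1` at which it holds; Fatou's lemma
  -- then passes to radius `1`
  have hex : ∀ k : ℕ, ∃ r ∈ Set.Ioo (1 : ℝ) (1 + 1 / (k + 1 : ℝ)), h r ≤ 2 * ∫⁻ u, G u := by
    intro k
    set A := Set.Ioo (1 : ℝ) (1 + 1 / (k + 1 : ℝ))
    have hA : volume A ≠ 0 := by simp [A]; positivity
    have hA' : volume A ≠ ⊤ := by simp [A]
    have hmeas : Measurable fun r => ENNReal.ofReal (r ^ n) * h r :=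
      (by fun_prop : Measurable fun r : ℝ => ENNReal.ofReal (r ^ n)).mul
        (measurable_lintegral_sphere n hG.measurable)
    obtain ⟨r, hr, hle⟩ := exists_le_setLAverage hA hA' hmeas.aemeasurable.restrict
    refine ⟨r, hr, ?_⟩
    have hr1 : 1 ≤ r ^ n := one_le_pow₀ hr.1.le
    have hsh := lintegral_shell_le n hG.measurable
      (ψ := A.indicator 1) (measurable_one.indicator measurableSet_Ioo)
    have hI : ∫⁻ r in A, ENNReal.ofReal (r ^ n) * h r ≤ 2 * volume A * ∫⁻ u, G u := by
      refine le_trans ?_ (hsh.trans_eq ?_)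
      · have hsub : A ⊆ Set.Ioi 0 := fun x hx => lt_trans one_pos hx.1
        rw [← Set.inter_eq_left.2 hsub, ← Measure.restrict_restrict measurableSet_Ioo,
          ← lintegral_indicator measurableSet_Ioo]
        refine lintegral_mono fun x => ?_
        rw [Set.inter_eq_left.2 hsub]
        by_cases hx : x ∈ A
        · refine (Set.indicator_of_mem hx _).le.trans (le_of_eq ?_)
          rw [Set.indicator_of_mem hx, Pi.one_apply, one_mul]
        · exact (Set.indicator_of_notMem hx _).le.trans zero_le
      · rw [lintegral_indicator_one measurableSet_Ioo]
    calc h r = 1 * h r := (one_mul _).symm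
      _ ≤ ENNReal.ofReal (r ^ n) * h r := by gcongr; simpa using hr1
      _ ≤ _ := hle
      _ ≤ 2 * ∫⁻ u, G u := by
        rw [setLAverage_eq]
        refine ENNReal.div_le_of_le_mul (hI.trans_eq (by ring))
  choose r hr hle using hex
  have hr1 : Tendsto r atTop (𝓝 1) := by
    refine tendsto_of_tendsto_of_tendsto_of_le_of_le tendsto_const_nhds
      (h := fun k : ℕ => 1 + 1 / (k + 1 : ℝ)) ?_ (fun k => (hr k).1.le) (fun k => (hr k).2.le)
    simpa using tendsto_const_nhds.add tendsto_one_div_add_atTop_nhds_zero_nat (a := (1 : ℝ))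
  calc _ = ∫⁻ θ, liminf (fun k => G (r k • (splitFirst n θ.1).2) * ENNReal.ofReal |θ.1 0|) atTop
        ∂σ := by
        refine lintegral_congr fun θ => (Tendsto.liminf_eq ?_).symm
        refine ENNReal.Tendsto.mul_const ?_ (Or.inr ENNReal.ofReal_ne_top)
        have := (hG.tendsto _).comp (hr1.smul_const (splitFirst n θ.1).2)
        simpa [Function.comp_def] using this
    _ ≤ liminf (fun k => h (r k)) atTop := lintegral_liminf_le fun k =>
        (measurable_sphere_integrand n hG.measurable).of_uncurry_left
    _ ≤ 2 * ∫⁻ u, G u :=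
        (liminf_le_liminf (Eventually.of_forall hle)).trans_eq (liminf_const _)

/-! ### Logarithmic moments of Gaussian type -/

lemma mellin_exp_neg_sq {s : ℂ} (hs : 0 < s.re) :
    mellin (fun x : ℝ => ((Real.exp (-x ^ 2) : ℝ) : ℂ)) s = Complex.Gamma (s / 2) / 2 := by
  have h := mellin_comp_rpow (fun x : ℝ => ((Real.exp (-x) : ℝ) : ℂ)) s 2
  have hre : 0 < (s / 2).re := by
    rw [show s / 2 = s / ((2 : ℝ) : ℂ) by norm_num, Complex.div_ofReal_re]; positivity
  rw [Complex.Gamma_eq_integral hre, Complex.GammaIntegral_eq_mellin]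
  simp only [Real.rpow_two, abs_two] at h
  rw [h, Complex.real_smul]
  push_cast
  ring

/-- Differentiating the Mellin transform `Γ(s / 2) / 2` of `exp (-r ^ 2)`. -/
lemma mellin_log_exp_neg_sq {s : ℝ} (hs : 0 < s) :
    MellinConvergent (fun x : ℝ => Real.log x • ((Real.exp (-x ^ 2) : ℝ) : ℂ)) s ∧
      HasDerivAt Complex.Gamma
        (4 * mellin (fun x : ℝ => Real.log x • ((Real.exp (-x ^ 2) : ℝ) : ℂ)) s)
        ((s / 2 : ℝ) : ℂ) := by
  have hcont : Continuous fun x : ℝ => ((Real.exp (-x ^ 2) : ℝ) : ℂ) := by fun_prop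
  have hs' : 0 < (s : ℂ).re := by simpa using hs
  obtain ⟨h1, h2⟩ := mellin_hasDerivAt_of_isBigO_rpow (E := ℂ) (a := s + 1) (b := 0)
    (f := fun x : ℝ => ((Real.exp (-x ^ 2) : ℝ) : ℂ)) (s := s)
    (hcont.continuousOn.locallyIntegrableOn measurableSet_Ioi)
    (by
      rw [← Asymptotics.isBigO_norm_left]
      simp_rw [Complex.norm_real, Asymptotics.isBigO_norm_left]
      refine (Asymptotics.IsBigO.of_bound 1 ?_).trans
        (isLittleO_exp_neg_mul_rpow_atTop zero_lt_one (-(s + 1))).isBigO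
      filter_upwards [eventually_ge_atTop 1] with x hx
      rw [one_mul, Real.norm_of_nonneg (Real.exp_nonneg _), Real.norm_of_nonneg (Real.exp_nonneg _)]
      exact Real.exp_le_exp.2 (by nlinarith))
    (by simp)
    (by
      simp_rw [neg_zero, Real.rpow_zero]
      exact (hcont.continuousWithinAt.tendsto).isBigO_one ℝ)
    hs'
  refine ⟨h1, ?_⟩
  have h3 : HasDerivAt
      (fun z : ℂ => 2 * mellin (fun x : ℝ => ((Real.exp (-x ^ 2) : ℝ) : ℂ)) (2 * z))
      (4 * mellin (fun x : ℝ => Real.log x • ((Real.exp (-x ^ 2) : ℝ) : ℂ)) s)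
      ((s / 2 : ℝ) : ℂ) := by
    have hz : (s : ℂ) = 2 * ((s / 2 : ℝ) : ℂ) := by push_cast; ring
    rw [hz] at h2
    have := (h2.comp ((s / 2 : ℝ) : ℂ) ((hasDerivAt_id _).const_mul (2 : ℂ))).const_mul 2
    rw [← hz] at this
    refine this.congr_deriv ?_
    ring
  refine h3.congr_of_eventuallyEq ?_
  have hopen : IsOpen {z : ℂ | 0 < z.re} := isOpen_lt continuous_const Complex.continuous_re
  filter_upwards [hopen.mem_nhds (show 0 < (((s / 2 : ℝ) : ℂ)).re by
    rw [Complex.ofReal_re]; positivity)] with z hz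
  rw [mellin_exp_neg_sq (by simpa using hz)]
  rw [mul_div_cancel_left₀ _ two_ne_zero]
  ring

lemma mellin_integrand_eq (k : ℕ) :
    ∀ r ∈ Set.Ioi (0 : ℝ), (r : ℂ) ^ ((((k : ℝ) + 1 : ℝ) : ℂ) - 1) •
        (Real.log r • ((Real.exp (-r ^ 2) : ℝ) : ℂ)) =
      ((r ^ k * (Real.exp (-r ^ 2) * Real.log r) : ℝ) : ℂ) := by
  intro r _
  rw [show ((((k : ℝ) + 1 : ℝ) : ℂ) - 1) = (k : ℂ) by push_cast; ring, Complex.cpow_natCast,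
    Complex.real_smul, smul_eq_mul]
  push_cast
  ring

lemma integrableOn_pow_mul_exp_neg_sq_mul_log (k : ℕ) :
    IntegrableOn (fun r : ℝ => r ^ k * (Real.exp (-r ^ 2) * Real.log r)) (Set.Ioi 0) := by
  have h := (mellin_log_exp_neg_sq (s := (k : ℝ) + 1) (by positivity)).1
  have h2 := (integrableOn_congr_fun (mellin_integrand_eq k) measurableSet_Ioi).1 h
  exact h2.re

lemma integral_pow_mul_exp_neg_sq_mul_log (k : ℕ) :
    ∫ r in Set.Ioi (0 : ℝ), r ^ k * (Real.exp (-r ^ 2) * Real.log r) =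
      deriv Real.Gamma (((k : ℝ) + 1) / 2) / 4 := by
  have h := (mellin_log_exp_neg_sq (s := (k : ℝ) + 1) (by positivity)).2
  have h2 : mellin (fun x : ℝ => Real.log x • ((Real.exp (-x ^ 2) : ℝ) : ℂ))
      (((k : ℝ) + 1 : ℝ) : ℂ) =
      ((∫ r in Set.Ioi (0 : ℝ), r ^ k * (Real.exp (-r ^ 2) * Real.log r) : ℝ) : ℂ) := by
    rw [mellin, setIntegral_congr_fun measurableSet_Ioi (mellin_integrand_eq k)]
    exact integral_ofReal
  have h3 := h.real_of_complex
  rw [h2] at h3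
  have h4 : (fun x : ℝ => (Complex.Gamma x).re) = Real.Gamma := by
    ext x
    rw [Complex.Gamma_ofReal, Complex.ofReal_re]
  rw [h4] at h3
  rw [h3.deriv, show (4 : ℂ) = ((4 : ℝ) : ℂ) by norm_num, ← Complex.ofReal_mul, Complex.ofReal_re]
  ring

lemma integral_pow_mul_exp_neg_sq (k : ℕ) :
    ∫ r in Set.Ioi (0 : ℝ), r ^ k * Real.exp (-r ^ 2) = Real.Gamma (((k : ℝ) + 1) / 2) / 2 := by
  have h := integral_rpow_mul_exp_neg_rpow (p := 2) (q := k) two_pos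
    (by have := k.cast_nonneg (α := ℝ); linarith)
  simp only [Real.rpow_natCast, Real.rpow_two] at h
  rw [h]
  ring

/-! ### The area of the sphere and the mean of `log |x₀|` -/

lemma integrable_exp_neg_sq_mul_log :
    Integrable (fun t : ℝ => Real.exp (-t ^ 2) * Real.log t) := by
  have h := (integrable_fun_norm_addHaar (volume : Measure ℝ)
    (f := fun t => Real.exp (-t ^ 2) * Real.log t)).2 (by
      simpa using integrableOn_pow_mul_exp_neg_sq_mul_log 0)
  simpa using h

lemma integral_exp_neg_sq_mul_log :
    ∫ t : ℝ, Real.exp (-t ^ 2) * Real.log t = deriv Real.Gamma (1 / 2) / 2 := by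
  have h := integral_comp_abs (f := fun t => Real.exp (-t ^ 2) * Real.log t)
  have h2 := integral_pow_mul_exp_neg_sq_mul_log 0
  simp only [pow_zero, one_mul, Nat.cast_zero, zero_add] at h2
  rw [h2] at h
  simp only [sq_abs, Real.log_abs] at h
  rw [h]
  ring

lemma integral_gaussian_norm {V : Type*} [NormedAddCommGroup V] [InnerProductSpace ℝ V]
    [FiniteDimensional ℝ V] [MeasurableSpace V] [BorelSpace V] {b : ℝ} (hb : 0 < b) (c : V) :
    ∫ v : V, Real.exp (-b * ‖v - c‖ ^ 2) = (Real.pi / b) ^ (Module.finrank ℝ V / 2 : ℝ) := by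
  rw [integral_sub_right_eq_self (fun v : V => Real.exp (-b * ‖v‖ ^ 2)) c]
  exact GaussianFourier.integral_rexp_neg_mul_sq_norm hb

lemma integrable_gaussian_norm {V : Type*} [NormedAddCommGroup V] [InnerProductSpace ℝ V]
    [FiniteDimensional ℝ V] [MeasurableSpace V] [BorelSpace V] {b : ℝ} (hb : 0 < b) (c : V) :
    Integrable fun v : V => Real.exp (-b * ‖v - c‖ ^ 2) := by
  refine Integrable.of_integral_ne_zero ?_
  rw [integral_gaussian_norm hb]
  have := Real.pi_pos
  positivity

/-- The area of the unit sphere `S^n` is `2 * π ^ ((n+1)/2) / Γ((n+1)/2)`. -/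
lemma toSphere_real_univ_mul_Gamma (n : ℕ) :
    (volume : Measure (EuclideanSpace ℝ (Fin (n + 1)))).toSphere.real Set.univ *
      (Real.Gamma (((n : ℝ) + 1) / 2) / 2) = Real.pi ^ (((n : ℝ) + 1) / 2) := by
  have h := integral_fun_norm_addHaar (volume : Measure (EuclideanSpace ℝ (Fin (n + 1))))
    (fun r => Real.exp (-r ^ 2))
  have h2 := GaussianFourier.integral_rexp_neg_mul_sq_norm
    (V := EuclideanSpace ℝ (Fin (n + 1))) one_pos
  simp only [neg_mul, one_mul, div_one, finrank_euclideanSpace, Fintype.card_fin] at h2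
  rw [h2] at h
  rw [Measure.toSphere_real_apply_univ, ← integral_pow_mul_exp_neg_sq n]
  simp only [finrank_euclideanSpace, Fintype.card_fin, Nat.add_sub_cancel, smul_eq_mul,
    nsmul_eq_mul] at h ⊢
  rw [mul_assoc, ← h]
  push_cast
  rfl

lemma ae_toSphere_coord_ne_zero (n : ℕ) :
    ∀ᵐ θ ∂(volume : Measure (EuclideanSpace ℝ (Fin (n + 1)))).toSphere, θ.1 0 ≠ 0 := by
  rw [ae_iff]
  have hm : MeasurableSet {θ : Metric.sphere (0 : EuclideanSpace ℝ (Fin (n + 1))) 1 |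
      ¬ θ.1 0 ≠ 0} := by
    have h0 : Measurable fun x : EuclideanSpace ℝ (Fin (n + 1)) => x 0 := by fun_prop
    simp only [ne_eq, not_not]
    exact (h0.comp measurable_subtype_coe) (measurableSet_singleton 0)
  rw [Measure.toSphere_apply' _ hm]
  refine mul_eq_zero_of_right _ (measure_mono_null (t := ((LinearMap.ker
    (EuclideanSpace.proj (𝕜 := ℝ) (0 : Fin (n + 1))).toLinearMap :
      Submodule ℝ (EuclideanSpace ℝ (Fin (n + 1)))) : Set _)) ?_ ?_)
  · rintro _ ⟨r, _, _, ⟨θ, hθ, rfl⟩, rfl⟩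
    have : θ.1 0 = 0 := by simpa using hθ
    simp [this]
  · refine Measure.addHaar_submodule _ _ fun h => ?_
    have : EuclideanSpace.single (0 : Fin (n + 1)) (1 : ℝ) ∈ LinearMap.ker
      (EuclideanSpace.proj (𝕜 := ℝ) (0 : Fin (n + 1))).toLinearMap := h ▸ Submodule.mem_top
    simp at this

lemma integrable_gaussian_mul_log_coord (n : ℕ) :
    Integrable (fun x : EuclideanSpace ℝ (Fin (n + 1)) =>
      Real.exp (-‖x‖ ^ 2) * Real.log (x 0)) ∧
    ∫ x : EuclideanSpace ℝ (Fin (n + 1)), Real.exp (-‖x‖ ^ 2) * Real.log (x 0) =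
      deriv Real.Gamma (1 / 2) / 2 * Real.pi ^ ((n : ℝ) / 2) := by
  have hG := integrable_gaussian_norm one_pos (0 : EuclideanSpace ℝ (Fin n))
  have hG' := integral_gaussian_norm one_pos (0 : EuclideanSpace ℝ (Fin n))
  have hfun : (fun x : EuclideanSpace ℝ (Fin (n + 1)) => Real.exp (-‖x‖ ^ 2) * Real.log (x 0)) =
      (fun p : ℝ × EuclideanSpace ℝ (Fin n) => (Real.exp (-p.1 ^ 2) * Real.log p.1) *
        Real.exp (-1 * ‖p.2 - 0‖ ^ 2)) ∘ splitFirst n := by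
    ext x
    simp only [Function.comp, norm_sq_eq_splitFirst, ← splitFirst_fst, neg_add, Real.exp_add,
      sub_zero, neg_mul, one_mul]
    ring
  constructor
  · rw [hfun]
    exact ((measurePreserving_splitFirst n).integrable_comp_emb
      (splitFirst n).measurableEmbedding).2 (integrable_exp_neg_sq_mul_log.mul_prod hG)
  · rw [hfun]
    have h := (measurePreserving_splitFirst n).integral_comp (splitFirst n).measurableEmbedding
      (fun p : ℝ × EuclideanSpace ℝ (Fin n) => (Real.exp (-p.1 ^ 2) * Real.log p.1) *
        Real.exp (-1 * ‖p.2 - 0‖ ^ 2))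
    simp only [Function.comp_def]
    rw [h]
    rw [Measure.volume_eq_prod, integral_prod_mul (fun t : ℝ => Real.exp (-t ^ 2) * Real.log t)
      (fun u : EuclideanSpace ℝ (Fin n) => Real.exp (-1 * ‖u - 0‖ ^ 2)), hG',
      integral_exp_neg_sq_mul_log]
    simp

/-- If `Z` is a standard Gaussian vector, `log |Z₀| = log ‖Z‖ + log |θ₀|` with `θ = Z / ‖Z‖`
uniform on the sphere; the first two expectations are logarithmic moments of Gaussian type.
Here and below `Real.log (x 0)` is `log |x₀|`, as `Real.log` is even. -/
lemma integral_toSphere_log_coord (n : ℕ) :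
    Integrable (fun θ : Metric.sphere (0 : EuclideanSpace ℝ (Fin (n + 1))) 1 => Real.log (θ.1 0))
      (volume : Measure (EuclideanSpace ℝ (Fin (n + 1)))).toSphere ∧
    ∫ θ : Metric.sphere (0 : EuclideanSpace ℝ (Fin (n + 1))) 1, Real.log (θ.1 0)
      ∂(volume : Measure (EuclideanSpace ℝ (Fin (n + 1)))).toSphere =
      (volume : Measure (EuclideanSpace ℝ (Fin (n + 1)))).toSphere.real Set.univ *
        ((realDigamma (1 / 2) - realDigamma (((n : ℝ) + 1) / 2)) / 2) := by
  set σ := (volume : Measure (EuclideanSpace ℝ (Fin (n + 1)))).toSphere with hσ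
  set ν := Measure.volumeIoiPow n with hν
  obtain ⟨hI, hV⟩ := integrable_gaussian_mul_log_coord n
  have hmp := measurePreserving_polar (volume : Measure (EuclideanSpace ℝ (Fin (n + 1))))
  rw [finrank_euclidean_sub_one, ← hσ, ← hν] at hmp
  rw [← hmp.integrable_comp_emb measurableEmbedding_polar] at hI
  rw [← hmp.integral_comp measurableEmbedding_polar] at hV
  have hI1 : Integrable (fun r : Set.Ioi (0 : ℝ) => Real.exp (-r.1 ^ 2) * Real.log r.1) ν :=
    (integrable_volumeIoiPow_iff n fun r => Real.exp (-r ^ 2) * Real.log r).2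
      (integrableOn_pow_mul_exp_neg_sq_mul_log n)
  have hV1 : ∫ r : Set.Ioi (0 : ℝ), Real.exp (-r.1 ^ 2) * Real.log r.1 ∂ν =
      deriv Real.Gamma (((n : ℝ) + 1) / 2) / 4 :=
    (integral_volumeIoiPow n fun r => Real.exp (-r ^ 2) * Real.log r).trans
      (integral_pow_mul_exp_neg_sq_mul_log n)
  have hV0 : ∫ r : Set.Ioi (0 : ℝ), Real.exp (-r.1 ^ 2) ∂ν =
      Real.Gamma (((n : ℝ) + 1) / 2) / 2 :=
    (integral_volumeIoiPow n fun r => Real.exp (-r ^ 2)).trans (integral_pow_mul_exp_neg_sq n)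
  have hJ := (integrable_const (1 : ℝ) (μ := σ)).mul_prod hI1
  have hae : (fun p : Metric.sphere (0 : EuclideanSpace ℝ (Fin (n + 1))) 1 × Set.Ioi (0 : ℝ) =>
      Real.exp (-‖p.2.1 • p.1.1‖ ^ 2) * Real.log ((p.2.1 • p.1.1) 0) -
        1 * (Real.exp (-p.2.1 ^ 2) * Real.log p.2.1)) =ᵐ[σ.prod ν]
      fun p => Real.log (p.1.1 0) * Real.exp (-p.2.1 ^ 2) := by
    have h0 := (Measure.quasiMeasurePreserving_fst (μ := σ) (ν := ν)).ae
      (ae_toSphere_coord_ne_zero n)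
    filter_upwards [h0] with p hp
    have hr : 0 < p.2.1 := p.2.2
    have hθ : ‖p.1.1‖ = 1 := by simp
    rw [norm_smul, hθ, mul_one, Real.norm_eq_abs, abs_of_pos hr, PiLp.smul_apply, smul_eq_mul,
      Real.log_mul hr.ne' hp]
    ring
  have hK := (hI.sub hJ).congr hae
  have hpos : 0 < Real.Gamma (((n : ℝ) + 1) / 2) := Real.Gamma_pos_of_pos (by positivity)
  have hν0 : (ae ν).NeBot := by
    rw [ae_neBot]
    rintro h
    rw [h, integral_zero_measure] at hV0
    linarith
  refine ⟨?_, ?_⟩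
  · obtain ⟨r, hr⟩ := hK.prod_left_ae.exists
    have := hr.mul_const (Real.exp (-r.1 ^ 2))⁻¹
    simpa [mul_assoc, mul_inv_cancel₀ (Real.exp_ne_zero _)] using this
  · have hE : ∫ p, (Real.log (p.1.1 0) * Real.exp (-p.2.1 ^ 2)) ∂(σ.prod ν) =
        deriv Real.Gamma (1 / 2) / 2 * Real.pi ^ ((n : ℝ) / 2) -
          σ.real Set.univ * (deriv Real.Gamma (((n : ℝ) + 1) / 2) / 4) := by
      rw [← integral_congr_ae hae]
      refine (integral_sub hI hJ).trans ?_
      simp only [Function.comp_def]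
      rw [hV, integral_prod_mul (fun _ => (1 : ℝ))
        (fun r : Set.Ioi (0 : ℝ) => Real.exp (-r.1 ^ 2) * Real.log r.1), hV1]
      simp
    rw [integral_prod_mul (fun θ : Metric.sphere (0 : EuclideanSpace ℝ (Fin (n + 1))) 1 =>
      Real.log (θ.1 0)) (fun r : Set.Ioi (0 : ℝ) => Real.exp (-r.1 ^ 2)), hV0] at hE
    have hA := toSphere_real_univ_mul_Gamma n
    rw [← hσ] at hA
    have hpi : Real.pi ^ (((n : ℝ) + 1) / 2) = Real.pi ^ ((n : ℝ) / 2) * √Real.pi := by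
      rw [Real.sqrt_eq_rpow, ← Real.rpow_add Real.pi_pos]
      ring_nf
    rw [hpi] at hA
    have hsq : 0 < √Real.pi := Real.sqrt_pos.2 Real.pi_pos
    have hpin : Real.pi ^ ((n : ℝ) / 2) =
        σ.real Set.univ * (Real.Gamma (((n : ℝ) + 1) / 2) / 2) / √Real.pi := by
      rw [hA, mul_div_cancel_right₀ _ hsq.ne']
    rw [hpin] at hE
    simp only [realDigamma, logDeriv_apply, Real.Gamma_one_half_eq]
    refine mul_right_cancel₀ (half_pos hpos).ne' (hE.trans ?_)
    field_simp
    ring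

/-! ### The Shannon lower bound on the sphere -/

lemma toSphere_univ_pos (n : ℕ) :
    0 < (volume : Measure (EuclideanSpace ℝ (Fin (n + 1)))).toSphere.real Set.univ := by
  have h := toSphere_real_univ_mul_Gamma n
  have hpos : 0 < Real.Gamma (((n : ℝ) + 1) / 2) := Real.Gamma_pos_of_pos (by positivity)
  have hpi : 0 < Real.pi ^ (((n : ℝ) + 1) / 2) := Real.rpow_pos_of_pos Real.pi_pos _
  rw [← h] at hpi
  exact pos_of_mul_pos_left hpi (half_pos hpos).le

lemma sphereUniform_eq (n : ℕ) :
    sphereUniform (n + 1) =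
      ((volume : Measure (EuclideanSpace ℝ (Fin (n + 1)))).toSphere Set.univ)⁻¹ •
        (volume : Measure (EuclideanSpace ℝ (Fin (n + 1)))).toSphere.map Subtype.val := by
  rw [sphereUniform, Measure.map_smul]

lemma measurableEmbedding_sphere_val (n : ℕ) : MeasurableEmbedding
    (Subtype.val : Metric.sphere (0 : EuclideanSpace ℝ (Fin (n + 1))) 1 → _) :=
  MeasurableEmbedding.subtype_coe Metric.isClosed_sphere.measurableSet

instance isProbabilityMeasure_sphereUniform (n : ℕ) :
    IsProbabilityMeasure (sphereUniform (n + 1)) := by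
  constructor
  rw [sphereUniform_eq, Measure.smul_apply,
    Measure.map_apply measurable_subtype_coe MeasurableSet.univ, Set.preimage_univ, smul_eq_mul]
  refine ENNReal.inv_mul_cancel ?_ (measure_ne_top _ _)
  intro h
  have := toSphere_univ_pos n
  simp only [Measure.real, h, ENNReal.toReal_zero, lt_self_iff_false] at this

lemma integral_sphereUniform (n : ℕ) (f : EuclideanSpace ℝ (Fin (n + 1)) → ℝ) :
    ∫ x, f x ∂(sphereUniform (n + 1)) =
      ((volume : Measure (EuclideanSpace ℝ (Fin (n + 1)))).toSphere.real Set.univ)⁻¹ *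
        ∫ θ, f θ.1 ∂(volume : Measure (EuclideanSpace ℝ (Fin (n + 1)))).toSphere := by
  rw [sphereUniform_eq, integral_smul_measure, (measurableEmbedding_sphere_val n).integral_map,
    ENNReal.toReal_inv, smul_eq_mul, Measure.real]

lemma integrable_sphereUniform_iff (n : ℕ) (f : EuclideanSpace ℝ (Fin (n + 1)) → ℝ) :
    Integrable f (sphereUniform (n + 1)) ↔
      Integrable (fun θ : Metric.sphere (0 : EuclideanSpace ℝ (Fin (n + 1))) 1 => f θ.1)
        (volume : Measure (EuclideanSpace ℝ (Fin (n + 1)))).toSphere := by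
  have hpos := toSphere_univ_pos n
  rw [sphereUniform_eq, integrable_smul_measure,
    (measurableEmbedding_sphere_val n).integrable_map_iff]
  · rfl
  · exact ENNReal.inv_ne_zero.2 (measure_ne_top _ _)
  · rw [ENNReal.inv_ne_top]
    intro h
    simp only [Measure.real, h, ENNReal.toReal_zero, lt_self_iff_false] at hpos

lemma ae_sphereUniform {n : ℕ} {p : EuclideanSpace ℝ (Fin (n + 1)) → Prop}
    (h : ∀ᵐ θ ∂(volume : Measure (EuclideanSpace ℝ (Fin (n + 1)))).toSphere, p θ.1) :
    ∀ᵐ x ∂(sphereUniform (n + 1)), p x := by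
  rw [sphereUniform_eq]
  exact Measure.ae_smul_measure (((measurableEmbedding_sphere_val n).ae_map_iff).2 h) _

lemma integral_sphereUniform_log_coord (n : ℕ) :
    ∫ x, Real.log (x 0) ∂(sphereUniform (n + 1)) =
      (realDigamma (1 / 2) - realDigamma (((n : ℝ) + 1) / 2)) / 2 := by
  rw [integral_sphereUniform n fun x => Real.log (x 0), (integral_toSphere_log_coord n).2,
    inv_mul_cancel_left₀ (toSphere_univ_pos n).ne']

/-- The law of the projection of a uniform point of the sphere to the equatorial hyperplane has
density at most `(A / 2 * |x₀|)⁻¹`, where `A` is the area of the sphere. -/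
lemma integral_sphereUniform_proj_le (n : ℕ) {g : EuclideanSpace ℝ (Fin n) → ℝ}
    (hg : Continuous g) (hg0 : ∀ u, 0 ≤ g u) (hgi : Integrable g) :
    Integrable (fun x => g (splitFirst n x).2 * |x 0|) (sphereUniform (n + 1)) ∧
    (volume : Measure (EuclideanSpace ℝ (Fin (n + 1)))).toSphere.real Set.univ / 2 *
      ∫ x, g (splitFirst n x).2 * |x 0| ∂(sphereUniform (n + 1)) ≤ ∫ u, g u := by
  have h := lintegral_sphere_proj_le n (G := fun u => ENNReal.ofReal (g u))
    (ENNReal.continuous_ofReal.comp hg)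
  simp only [← ENNReal.ofReal_mul (hg0 _)] at h
  rw [← ofReal_integral_eq_lintegral_ofReal hgi (ae_of_all _ hg0)] at h
  have hcont : Continuous fun θ : Metric.sphere (0 : EuclideanSpace ℝ (Fin (n + 1))) 1 =>
      g (splitFirst n θ.1).2 * |θ.1 0| := by
    have h1 : Continuous fun θ : Metric.sphere (0 : EuclideanSpace ℝ (Fin (n + 1))) 1 =>
        g (splitFirst n θ.1).2 :=
      (hg.comp (continuous_splitFirst_snd n)).comp continuous_subtype_val
    exact h1.mul (by fun_prop)
  have hnn : ∀ θ : Metric.sphere (0 : EuclideanSpace ℝ (Fin (n + 1))) 1,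
      0 ≤ g (splitFirst n θ.1).2 * |θ.1 0| := fun θ => mul_nonneg (hg0 _) (abs_nonneg _)
  have hI : Integrable (fun θ : Metric.sphere (0 : EuclideanSpace ℝ (Fin (n + 1))) 1 =>
      g (splitFirst n θ.1).2 * |θ.1 0|)
      (volume : Measure (EuclideanSpace ℝ (Fin (n + 1)))).toSphere := by
    refine ⟨hcont.measurable.aestronglyMeasurable, ?_⟩
    rw [hasFiniteIntegral_iff_ofReal (ae_of_all _ hnn)]
    exact h.trans_lt (ENNReal.mul_lt_top (by simp) ENNReal.ofReal_lt_top)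
  refine ⟨(integrable_sphereUniform_iff n _).2 hI, ?_⟩
  rw [integral_sphereUniform n fun x => g (splitFirst n x).2 * |x 0|]
  have hpos := toSphere_univ_pos n
  have h2 : ∫ θ : Metric.sphere (0 : EuclideanSpace ℝ (Fin (n + 1))) 1,
      g (splitFirst n θ.1).2 * |θ.1 0|
      ∂(volume : Measure (EuclideanSpace ℝ (Fin (n + 1)))).toSphere ≤ 2 * ∫ u, g u := by
    rw [← ofReal_integral_eq_lintegral_ofReal hI (ae_of_all _ hnn), two_mul,
      ← ENNReal.ofReal_add (integral_nonneg hg0) (integral_nonneg hg0), ← two_mul] at h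
    exact (ENNReal.ofReal_le_ofReal_iff
      (mul_nonneg two_pos.le (integral_nonneg hg0))).1 h
  rw [div_mul_eq_mul_div, mul_inv_cancel_left₀ hpos.ne']
  linarith

/-- The Gibbs inequality behind the Shannon lower bound. The mixture of Gaussians of variance `s`
centred at the (projected) code points is compared with the law of the projected point. -/
lemma gibbs_sphere {n : ℕ} {ι : Type*} [Fintype ι]
    (c : ι → EuclideanSpace ℝ (Fin (n + 1))) (q : EuclideanSpace ℝ (Fin (n + 1)) → ι)
    (hint : Integrable (fun x => ‖x - c (q x)‖ ^ 2) (sphereUniform (n + 1))) {s : ℝ} (hs : 0 < s) :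
    Real.log ((volume : Measure (EuclideanSpace ℝ (Fin (n + 1)))).toSphere.real Set.univ / 2) +
        (realDigamma (1 / 2) - realDigamma (((n : ℝ) + 1) / 2)) / 2 -
        (n : ℝ) / 2 * Real.log (2 * Real.pi * s) -
        (∫ x, ‖x - c (q x)‖ ^ 2 ∂(sphereUniform (n + 1))) / (2 * s) ≤
      Real.log (Fintype.card ι) := by
  set A := (volume : Measure (EuclideanSpace ℝ (Fin (n + 1)))).toSphere.real Set.univ
  have hA : 0 < A := toSphere_univ_pos n
  set M : ℝ := ((Fintype.card ι : ℕ) : ℝ) with hM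
  have hMpos : 0 < M := Nat.cast_pos.2 (Fintype.card_pos_iff.2 ⟨q 0⟩)
  have hv : 0 < 2 * Real.pi * s := by have := Real.pi_pos; positivity
  set K : ℝ := (2 * Real.pi * s) ^ (-((n : ℝ) / 2)) with hK
  have hKpos : 0 < K := Real.rpow_pos_of_pos hv _
  set g : ι → EuclideanSpace ℝ (Fin n) → ℝ := fun i u =>
    K * Real.exp (-(2 * s)⁻¹ * ‖u - (splitFirst n (c i)).2‖ ^ 2) with hg
  have hb : 0 < (2 * s)⁻¹ := by positivity
  have hgpos : ∀ i u, 0 < g i u := fun i u => by positivity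
  have hgi : ∀ i, Integrable (g i) := fun i => (integrable_gaussian_norm hb _).const_mul K
  have hgone : ∀ i, ∫ u, g i u = 1 := by
    intro i
    simp only [hg]
    rw [integral_const_mul, integral_gaussian_norm hb, finrank_euclideanSpace, Fintype.card_fin,
      div_inv_eq_mul, show Real.pi * (2 * s) = 2 * Real.pi * s by ring, hK,
      ← Real.rpow_add hv, neg_add_cancel, Real.rpow_zero]
  have hp : ∀ i, _ := fun i => integral_sphereUniform_proj_le n
    (g := g i) (by fun_prop) (fun u => (hgpos i u).le) (hgi i)
  set Z : EuclideanSpace ℝ (Fin (n + 1)) → ℝ := fun x =>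
    ∑ i, A / 2 * (g i (splitFirst n x).2 * |x 0|) with hZ
  have hZi : Integrable Z (sphereUniform (n + 1)) :=
    integrable_finsetSum _ fun i _ => (hp i).1.const_mul _
  have hZle : ∫ x, Z x ∂(sphereUniform (n + 1)) ≤ M := by
    simp only [hZ]
    rw [integral_finsetSum _ fun i _ => (hp i).1.const_mul _]
    simp only [integral_const_mul]
    calc _ ≤ ∑ _i : ι, (1 : ℝ) := Finset.sum_le_sum fun i _ => (hp i).2.trans_eq (hgone i)
      _ = M := by simp [hM]
  have hlog : Integrable (fun x => Real.log (x 0)) (sphereUniform (n + 1)) :=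
    (integrable_sphereUniform_iff n fun x => Real.log (x 0)).2 (integral_toSphere_log_coord n).1
  have hpt : ∀ᵐ x ∂(sphereUniform (n + 1)),
      Real.log (x 0) + (Real.log (A / 2) - (n : ℝ) / 2 * Real.log (2 * Real.pi * s)) -
        ‖x - c (q x)‖ ^ 2 / (2 * s) ≤ Z x / M + (Real.log M - 1) := by
    filter_upwards [ae_sphereUniform (p := fun x => x 0 ≠ 0) (ae_toSphere_coord_ne_zero n)] with x hx
    have hx' : 0 < |x 0| := abs_pos.2 hx
    -- the mixture is at least its term at the code point used for `x`
    have hone : A / 2 * (g (q x) (splitFirst n x).2 * |x 0|) ≤ Z x :=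
      Finset.single_le_sum (f := fun i => A / 2 * (g i (splitFirst n x).2 * |x 0|))
        (fun i _ => by have := hgpos i (splitFirst n x).2; positivity) (Finset.mem_univ (q x))
    have hgq := hgpos (q x) (splitFirst n x).2
    have hone_pos : 0 < A / 2 * (g (q x) (splitFirst n x).2 * |x 0|) := by positivity
    have hZx : 0 < Z x := hone_pos.trans_le hone
    have h1 : Real.log (A / 2 * (g (q x) (splitFirst n x).2 * |x 0|)) =
        Real.log (A / 2) + (-((n : ℝ) / 2) * Real.log (2 * Real.pi * s) +
          -(2 * s)⁻¹ * ‖(splitFirst n x).2 - (splitFirst n (c (q x))).2‖ ^ 2 +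
          Real.log (x 0)) := by
      rw [Real.log_mul (by positivity) (by positivity), Real.log_mul hgq.ne' hx'.ne', Real.log_abs,
        Real.log_mul hKpos.ne' (Real.exp_ne_zero _), Real.log_exp, hK, Real.log_rpow hv]
    have h2 : Real.log (Z x) ≤ Z x / M + (Real.log M - 1) := by
      have := Real.log_le_sub_one_of_pos (div_pos hZx hMpos)
      rw [Real.log_div hZx.ne' hMpos.ne'] at this
      linarith
    have h3 : ‖(splitFirst n x).2 - (splitFirst n (c (q x))).2‖ ^ 2 ≤ ‖x - c (q x)‖ ^ 2 := by
      rw [norm_sq_eq_splitFirst n (x - c (q x)), splitFirst_sub]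
      exact le_add_of_nonneg_left (sq_nonneg _)
    have h4 := Real.log_le_log hone_pos hone
    have h5 := mul_le_mul_of_nonneg_left h3 hb.le
    rw [h1] at h4
    rw [div_eq_inv_mul (‖x - c (q x)‖ ^ 2)]
    linarith
  have hadd : Integrable (fun x : EuclideanSpace ℝ (Fin (n + 1)) => Real.log (x 0) +
      (Real.log (A / 2) - (n : ℝ) / 2 * Real.log (2 * Real.pi * s))) (sphereUniform (n + 1)) :=
    hlog.add (integrable_const _)
  have hmono := integral_mono_ae (hadd.sub (hint.div_const (2 * s)))
    ((hZi.div_const M).add (integrable_const (Real.log M - 1))) hpt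
  simp only [Pi.sub_apply, Pi.add_apply] at hmono
  rw [integral_sub hadd (hint.div_const (2 * s)),
    integral_add (hZi.div_const M) (integrable_const _),
    integral_add hlog (integrable_const _), integral_sphereUniform_log_coord,
    integral_div, integral_div, integral_const, integral_const, probReal_univ, one_smul,
    one_smul] at hmono
  have h6 : (∫ x, Z x ∂(sphereUniform (n + 1))) / M ≤ 1 := (div_le_one hMpos).2 hZle
  linarith

/-- The Shannon lower bound on the sphere: optimizing `gibbs_sphere` over the variance. -/
lemma shannon_lower_bound_sphere {n : ℕ} (hn : 1 ≤ n) {ι : Type*} [Fintype ι]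
    (c : ι → EuclideanSpace ℝ (Fin (n + 1))) (q : EuclideanSpace ℝ (Fin (n + 1)) → ι)
    (hint : Integrable (fun x => ‖x - c (q x)‖ ^ 2) (sphereUniform (n + 1))) :
    (n : ℝ) / (2 * Real.pi * Real.exp 1) * Real.exp (2 / n *
      (Real.log ((volume : Measure (EuclideanSpace ℝ (Fin (n + 1)))).toSphere.real Set.univ / 2) +
        (realDigamma (1 / 2) - realDigamma (((n : ℝ) + 1) / 2)) / 2 -
        Real.log (Fintype.card ι))) ≤ ∫ x, ‖x - c (q x)‖ ^ 2 ∂(sphereUniform (n + 1)) := by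
  set H := Real.log
    ((volume : Measure (EuclideanSpace ℝ (Fin (n + 1)))).toSphere.real Set.univ / 2) +
        (realDigamma (1 / 2) - realDigamma (((n : ℝ) + 1) / 2)) / 2 with hH
  have hn' : (0 : ℝ) < n := by exact_mod_cast hn
  -- the variance per coordinate at which the bound of `gibbs_sphere` is tight
  set s : ℝ := Real.exp (2 / n * (H - Real.log (Fintype.card ι))) / (2 * Real.pi * Real.exp 1)
    with hs
  have hpi := Real.pi_pos
  have hspos : 0 < s := by positivity
  have h := gibbs_sphere c q hint hspos
  have hlog : Real.log (2 * Real.pi * s) = 2 / n * (H - Real.log (Fintype.card ι)) - 1 := by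
    have : 2 * Real.pi * s = Real.exp (2 / n * (H - Real.log (Fintype.card ι)) - 1) := by
      rw [Real.exp_sub, hs]
      field_simp
    rw [this, Real.log_exp]
  rw [← hH, hlog] at h
  have h2 : (n : ℝ) / 2 * (2 / n * (H - Real.log (Fintype.card ι)) - 1) =
      H - Real.log (Fintype.card ι) - n / 2 := by
    field_simp
  rw [h2] at h
  have h3 : (n : ℝ) / 2 ≤ (∫ x, ‖x - c (q x)‖ ^ 2 ∂(sphereUniform (n + 1))) / (2 * s) := by
    linarith
  rw [le_div_iff₀ (by positivity)] at h3
  calc _ = (n : ℝ) / 2 * (2 * s) := by rw [hs]; ring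
    _ ≤ _ := h3

lemma shannonConst_mul_eq {n : ℕ} (hn : 1 ≤ n) (N : ℕ) :
    shannonConst (n + 1) * (1 / 4 : ℝ) ^ ((N : ℝ) / n) =
    (n : ℝ) / (2 * Real.pi * Real.exp 1) * Real.exp (2 / n *
      (Real.log ((volume : Measure (EuclideanSpace ℝ (Fin (n + 1)))).toSphere.real Set.univ / 2) +
        (realDigamma (1 / 2) - realDigamma (((n : ℝ) + 1) / 2)) / 2 -
        Real.log ((2 : ℝ) ^ N))) := by
  have hn' : (0 : ℝ) < n := by exact_mod_cast hn
  have hA := toSphere_univ_pos n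
  have hG := toSphere_real_univ_mul_Gamma n
  have hGpos : 0 < Real.Gamma (((n : ℝ) + 1) / 2) := Real.Gamma_pos_of_pos (by positivity)
  have hA2 : Real.pi ^ (((n : ℝ) + 1) / 2) / Real.Gamma (((n : ℝ) + 1) / 2) =
      (volume : Measure (EuclideanSpace ℝ (Fin (n + 1)))).toSphere.real Set.univ / 2 := by
    rw [← hG]
    field_simp
  have h4 : (1 / 4 : ℝ) ^ ((N : ℝ) / n) = Real.exp (2 / n * (-Real.log ((2 : ℝ) ^ N))) := by
    rw [Real.rpow_def_of_pos (by norm_num), one_div, Real.log_inv, Real.log_pow,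
      show (4 : ℝ) = 2 ^ 2 by norm_num, Real.log_pow]
    congr 1
    push_cast
    ring
  rw [shannonConst]
  push_cast
  rw [add_sub_cancel_right, hA2, h4, Real.rpow_def_of_pos (half_pos hA), mul_assoc, mul_assoc,
    ← Real.exp_add, ← Real.exp_add]
  congr 2
  ring

lemma integrable_quantization_error {n N : ℕ}
    {Q : EuclideanSpace ℝ (Fin (n + 1)) → (Fin N → Bool)} (hQ : Measurable Q)
    (Qinv : (Fin N → Bool) → EuclideanSpace ℝ (Fin (n + 1))) :
    Integrable (fun x => ‖x - Qinv (Q x)‖ ^ 2) (sphereUniform (n + 1)) := by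
  rw [integrable_sphereUniform_iff n fun x => ‖x - Qinv (Q x)‖ ^ 2]
  obtain ⟨C, hC⟩ := (Set.finite_range fun i => ‖Qinv i‖).bddAbove
  have hm : Measurable fun x => ‖x - Qinv (Q x)‖ ^ 2 :=
    ((measurable_id.sub ((measurable_of_finite Qinv).comp hQ)).norm).pow_const 2
  refine Integrable.of_bound (hm.comp measurable_subtype_coe).aestronglyMeasurable ((1 + C) ^ 2)
    (ae_of_all _ fun θ => ?_)
  have h1 : ‖θ.1 - Qinv (Q θ.1)‖ ≤ 1 + C :=
    (norm_sub_le _ _).trans (add_le_add (by simp) (hC ⟨Q θ.1, rfl⟩))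
  rw [Real.norm_of_nonneg (by positivity)]
  exact pow_le_pow_left₀ (norm_nonneg _) h1 2

/-! ### Asymptotics and numerical values of the constant -/

/-- Robbins' upper bound, the counterpart of `Stirling.le_log_factorial_stirling`. -/
lemma log_factorial_le {n : ℕ} (hn : n ≠ 0) :
    Real.log n.factorial ≤ n * Real.log n - n + Real.log n / 2 + Real.log (2 * Real.pi) / 2 +
      1 / (12 * n) := by
  have hlim : Tendsto (fun k : ℕ => Real.log (Stirling.stirlingSeq k) - 1 / (12 * (k : ℝ))) atTop
      (𝓝 (Real.log (√Real.pi) - 0)) := by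
    refine (Stirling.tendsto_stirlingSeq_sqrt_pi.log (by positivity)).sub ?_
    have := (tendsto_one_div_atTop_nhds_zero_nat (𝕜 := ℝ)).const_mul (1 / 12)
    rw [mul_zero] at this
    exact this.congr fun k => by ring
  have hmono : ∀ k, n ≤ k → Real.log (Stirling.stirlingSeq n) - 1 / (12 * (n : ℝ)) ≤
      Real.log (Stirling.stirlingSeq k) - 1 / (12 * (k : ℝ)) := by
    intro k hk
    induction k, hk using Nat.le_induction with
    | base => exact le_rfl
    | succ k hk ih =>
      have hk0 : (0 : ℝ) < k := by
        exact_mod_cast (Nat.pos_of_ne_zero hn).trans_le hk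
      have h := Stirling.log_stirlingSeq_sdiff_le k
      have h2 : 1 / (12 * (k : ℝ) * (k + 1)) = 1 / (12 * (k : ℝ)) - 1 / (12 * ((k + 1 : ℕ) : ℝ)) := by
        push_cast
        field_simp
        ring
      linarith
  have h := ge_of_tendsto hlim (eventually_atTop.2 ⟨n, hmono⟩)
  have hn0 : (0 : ℝ) < n := by exact_mod_cast Nat.pos_of_ne_zero hn
  rw [Stirling.log_stirlingSeq_formula, Real.log_sqrt Real.pi_pos.le,
    Real.log_div hn0.ne' (Real.exp_ne_zero _), Real.log_exp, Real.log_mul two_ne_zero hn0.ne'] at h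
  rw [Real.log_mul two_ne_zero Real.pi_ne_zero]
  linarith

/-- The error of the approximation `x * log x - x` to `log Γ(x)`. -/
noncomputable def stirlingError (x : ℝ) : ℝ :=
  Real.log (Real.Gamma x) - (x * Real.log x - x)

/-- The powers of `π` in `shannonConst` cancel up to a bounded exponent divided by `d - 1`. -/
lemma shannonConst_eq {d : ℕ} (hd : 2 ≤ d) :
    shannonConst d = ((d : ℝ) - 1) / d * Real.exp ((Real.log Real.pi + realDigamma (1 / 2) +
      Real.log 2 + 1 - Real.log d - 2 * stirlingError ((d : ℝ) / 2) -
      realDigamma ((d : ℝ) / 2)) / ((d : ℝ) - 1)) := by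
  have hd' : (2 : ℝ) ≤ d := by exact_mod_cast hd
  have hd0 : (0 : ℝ) < d := by linarith
  have hd1 : (0 : ℝ) < d - 1 := by linarith
  have hG : 0 < Real.Gamma ((d : ℝ) / 2) := Real.Gamma_pos_of_pos (by positivity)
  have hpi := Real.pi_pos
  have hpos : 0 < Real.pi ^ ((d : ℝ) / 2) / Real.Gamma ((d : ℝ) / 2) := by positivity
  have h1 : 1 / (2 * Real.pi * Real.exp 1) = Real.exp (-Real.log 2 - Real.log Real.pi - 1) := by
    rw [Real.exp_sub, Real.exp_sub, Real.exp_neg, Real.exp_log two_pos, Real.exp_log hpi]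
    field_simp
  have h2 : (1 : ℝ) / d = Real.exp (-Real.log d) := by
    rw [Real.exp_neg, Real.exp_log hd0, one_div]
  rw [shannonConst, Real.rpow_def_of_pos hpos, div_eq_mul_one_div, h1, mul_assoc, mul_assoc,
    ← Real.exp_add, ← Real.exp_add, div_eq_mul_one_div ((d : ℝ) - 1) (d : ℝ), h2, mul_assoc,
    ← Real.exp_add, Real.log_div (by positivity) hG.ne', Real.log_rpow hpi, stirlingError,
    Real.log_div hd0.ne' two_ne_zero]
  congr 2
  field_simp
  ring

lemma realDigamma_bounds {x : ℝ} (hx : 1 < x) :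
    Real.log (x - 1) ≤ realDigamma x ∧ realDigamma x ≤ Real.log x := by
  have hx0 : 0 < x := by linarith
  have hG : 0 < Real.Gamma x := Real.Gamma_pos_of_pos hx0
  have hdiff : DifferentiableAt ℝ Real.Gamma x := Real.differentiableAt_Gamma fun m => by
    have := m.cast_nonneg (α := ℝ); linarith
  have hder : HasDerivAt (Real.log ∘ Real.Gamma) (realDigamma x) x := by
    have := hdiff.hasDerivAt.log hG.ne'
    simpa [realDigamma, logDeriv_apply, Function.comp_def] using this
  have hstep : ∀ y : ℝ, 0 < y →
      Real.log (Real.Gamma (y + 1)) - Real.log (Real.Gamma y) = Real.log y := by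
    intro y hy
    rw [Real.Gamma_add_one hy.ne', Real.log_mul hy.ne' (Real.Gamma_pos_of_pos hy).ne']
    ring
  constructor
  · have h := Real.convexOn_log_Gamma.slope_le_of_hasDerivAt (x := x - 1) (y := x)
      (Set.mem_Ioi.2 (by linarith)) (Set.mem_Ioi.2 hx0) (by linarith) hder
    have h2 := hstep (x - 1) (by linarith)
    rw [sub_add_cancel] at h2
    simpa [slope_def_field, h2] using h
  · have h := Real.convexOn_log_Gamma.le_slope_of_hasDerivAt (x := x) (y := x + 1)
      (Set.mem_Ioi.2 hx0) (Set.mem_Ioi.2 (by linarith)) (by linarith) hder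
    simpa [slope_def_field, hstep x hx0] using h

lemma abs_stirlingError_le {x : ℝ} (hx : 2 ≤ x) : |stirlingError x| ≤ 3 * Real.log x + 3 := by
  set m := ⌊x⌋₊ with hm
  have hx0 : 0 < x := by linarith
  have hmx : (m : ℝ) ≤ x := Nat.floor_le hx0.le
  have hxm : x < m + 1 := Nat.lt_floor_add_one x
  have hm2 : 2 ≤ m := Nat.le_floor (by exact_mod_cast hx)
  have hm2' : (2 : ℝ) ≤ m := by exact_mod_cast hm2
  have hm0 : (0 : ℝ) < m := by linarith
  have hlogm : 0 ≤ Real.log m := Real.log_nonneg (by linarith)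
  have hlogmx : Real.log m ≤ Real.log x := Real.log_le_log hm0 hmx
  have hpi1 : Real.log (2 * Real.pi) ≤ 2 * 2 := by
    rw [Real.log_le_iff_le_exp (by positivity)]
    have h1 := Real.pi_lt_four
    have h2 := Real.add_one_le_exp (1 : ℝ)
    have h3 : Real.exp (2 * 2) = Real.exp 1 ^ 4 := by rw [← Real.exp_nat_mul]; norm_num
    rw [h3]
    calc 2 * Real.pi ≤ 2 ^ 4 := by linarith
      _ ≤ _ := pow_le_pow_left₀ (by norm_num) (by linarith) 4
  have hpi0 : 0 ≤ Real.log (2 * Real.pi) := Real.log_nonneg (by have := Real.pi_gt_three; linarith)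
  have hup : Real.log (Real.Gamma x) ≤ Real.log m.factorial := by
    rw [← Real.Gamma_nat_eq_factorial]
    exact Real.log_le_log (Real.Gamma_pos_of_pos hx0) (Real.Gamma_strictMonoOn_Ici.monotoneOn
      (Set.mem_Ici.2 hx) (Set.mem_Ici.2 (by linarith)) hxm.le)
  have hlo : Real.log m.factorial - Real.log m ≤ Real.log (Real.Gamma x) := by
    rw [← Real.Gamma_nat_eq_factorial, Real.Gamma_add_one hm0.ne', Real.log_mul hm0.ne'
      (Real.Gamma_pos_of_pos hm0).ne', add_sub_cancel_left]
    exact Real.log_le_log (Real.Gamma_pos_of_pos hm0) (Real.Gamma_strictMonoOn_Ici.monotoneOn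
      (Set.mem_Ici.2 hm2') (Set.mem_Ici.2 hx) hmx)
  have h1 := Stirling.le_log_factorial_stirling (n := m) (by omega)
  have h2 := log_factorial_le (n := m) (by omega)
  have h3 : 1 / (12 * (m : ℝ)) ≤ 1 := by
    rw [div_le_one (by positivity)]
    linarith
  -- `x log x - x` is compared with its value at `m` by the tangent bounds on `log (x / m)`
  have h4 : x * Real.log x - x ≤ m * Real.log m - m + Real.log x := by
    have h := Real.log_le_sub_one_of_pos (div_pos hx0 hm0)
    rw [Real.log_div hx0.ne' hm0.ne', div_sub_one hm0.ne', le_div_iff₀ hm0] at h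
    nlinarith [hlogm.trans hlogmx]
  have h5 : m * Real.log m - m ≤ x * Real.log x - x := by
    have h := Real.log_le_sub_one_of_pos (div_pos hm0 hx0)
    rw [Real.log_div hm0.ne' hx0.ne', div_sub_one hx0.ne', le_div_iff₀ hx0] at h
    nlinarith
  rw [stirlingError, abs_le]
  constructor <;> linarith

theorem tendsto_shannonConst : Tendsto shannonConst atTop (𝓝 1) := by
  set C : ℝ := Real.log Real.pi + realDigamma (1 / 2) + Real.log 2 + 1 with hC
  have hfrac : Tendsto (fun d : ℕ => ((d : ℝ) - 1) / d) atTop (𝓝 1) := by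
    have h := (tendsto_one_div_atTop_nhds_zero_nat (𝕜 := ℝ)).const_sub 1
    rw [sub_zero] at h
    refine h.congr' ?_
    filter_upwards [eventually_ge_atTop 1] with d hd
    have : (d : ℝ) ≠ 0 := by positivity
    field_simp
  have hbound : Tendsto (fun d : ℕ => (|C| + 6 + 8 * Real.log d) / ((d : ℝ) - 1)) atTop (𝓝 0) := by
    have h0 := ((Real.tendsto_pow_log_div_mul_add_atTop 1 (-1) 0 one_ne_zero).comp
      tendsto_natCast_atTop_atTop).const_mul (|C| + 6)
    have h1 := ((Real.tendsto_pow_log_div_mul_add_atTop 1 (-1) 1 one_ne_zero).comp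
      tendsto_natCast_atTop_atTop).const_mul 8
    have h := h0.add h1
    simp only [mul_zero, add_zero] at h
    refine h.congr fun d => ?_
    simp only [Function.comp, pow_zero, pow_one, one_mul, ← sub_eq_add_neg]
    ring
  have hexp : Tendsto (fun d : ℕ => (C - Real.log d - 2 * stirlingError ((d : ℝ) / 2) -
      realDigamma ((d : ℝ) / 2)) / ((d : ℝ) - 1)) atTop (𝓝 0) := by
    refine squeeze_zero_norm' ?_ hbound
    filter_upwards [eventually_ge_atTop 4] with d hd
    have hd' : (4 : ℝ) ≤ d := by exact_mod_cast hd
    have hx : (2 : ℝ) ≤ (d : ℝ) / 2 := by linarith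
    have hlog : Real.log ((d : ℝ) / 2) ≤ Real.log d :=
      Real.log_le_log (by linarith) (by linarith)
    have h1 := abs_le.1 (abs_stirlingError_le hx)
    have h2 := realDigamma_bounds (x := (d : ℝ) / 2) (by linarith)
    have h3 : 0 ≤ Real.log ((d : ℝ) / 2 - 1) := Real.log_nonneg (by linarith)
    have h4 := neg_abs_le C
    have h5 := le_abs_self C
    rw [Real.norm_eq_abs, abs_div, abs_of_pos (show (0 : ℝ) < d - 1 by linarith)]
    refine div_le_div_of_nonneg_right (abs_le.2 ⟨?_, ?_⟩) (by linarith) <;> linarith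
  have h := hfrac.mul (Real.continuous_exp.continuousAt.tendsto.comp hexp)
  rw [Real.exp_zero, one_mul] at h
  refine h.congr' ?_
  filter_upwards [eventually_ge_atTop 2] with d hd
  rw [shannonConst_eq hd]
  rfl

lemma realDigamma_one_half :
    realDigamma (1 / 2) = -(Real.eulerMascheroniConstant + 2 * Real.log 2) := by
  rw [realDigamma, logDeriv_apply, Real.hasDerivAt_Gamma_one_half.deriv, Real.Gamma_one_half_eq,
    mul_comm, mul_div_assoc, neg_div, div_self (Real.sqrt_pos.2 Real.pi_pos).ne']
  ring

lemma realDigamma_natCast_add_one (k : ℕ) :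
    realDigamma ((k : ℝ) + 1) = -Real.eulerMascheroniConstant + harmonic k := by
  rw [realDigamma, logDeriv_apply, Real.deriv_Gamma_nat, Real.Gamma_nat_eq_factorial,
    mul_div_cancel_left₀ _ (by positivity)]

/-- In even dimension `d = 2 * (k + 1)` all factors of `π` and Euler's constant cancel, and the
remaining error is that of Stirling's formula. -/
lemma shannonConst_even (k : ℕ) : ∃ ε : ℝ, 0 ≤ ε ∧ ε ≤ 1 / (6 * ((k : ℝ) + 1)) ∧
    shannonConst (2 * (k + 1)) = (2 * (k : ℝ) + 1) / (2 * ((k : ℝ) + 1)) *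
      Real.exp ((1 - 3 * Real.log 2 - harmonic k - ε) / (2 * (k : ℝ) + 1)) := by
  have hx : (((2 * (k + 1) : ℕ) : ℝ)) / 2 = (k : ℝ) + 1 := by push_cast; ring
  have hk : (0 : ℝ) < (k : ℝ) + 1 := by positivity
  have h1 := Stirling.le_log_factorial_stirling (n := k + 1) (by omega)
  have h2 := log_factorial_le (n := k + 1) (by omega)
  have hpi := Real.pi_pos
  have hfac : Real.log (Real.Gamma ((k : ℝ) + 1)) =
      Real.log ((k + 1).factorial : ℝ) - Real.log ((k : ℝ) + 1) := by
    rw [← Real.Gamma_nat_eq_factorial]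
    push_cast
    rw [Real.Gamma_add_one hk.ne', Real.log_mul hk.ne' (Real.Gamma_pos_of_pos hk).ne']
    ring
  push_cast at h1 h2
  rw [Real.log_mul two_ne_zero hpi.ne'] at h1 h2
  refine ⟨2 * stirlingError ((k : ℝ) + 1) + Real.log ((k : ℝ) + 1) - Real.log 2 -
    Real.log Real.pi, ?_, ?_, ?_⟩
  · rw [stirlingError, hfac]
    linarith
  · rw [stirlingError, hfac]
    have : 1 / (6 * ((k : ℝ) + 1)) = 2 * (1 / (12 * ((k : ℝ) + 1))) := by field_simp; norm_num
    linarith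
  · rw [shannonConst_eq (by omega), hx, realDigamma_one_half, realDigamma_natCast_add_one]
    push_cast
    rw [Real.log_mul two_ne_zero hk.ne']
    ring_nf

/-- `exp E` is located by `(1 + E / 32) ^ 32 ≤ exp E ≤ (1 - E / 32) ^ (-32)`. -/
lemma abs_mul_exp_sub_lt {E lo hi a t ε : ℝ} (ha : 0 < a) (hlo : lo ≤ E) (hhi : E ≤ hi)
    (hlo0 : 0 ≤ 1 + lo / 32) (hhi0 : 0 < 1 - hi / 32) (h1 : t - ε < a * (1 + lo / 32) ^ 32)
    (h2 : a < (t + ε) * (1 - hi / 32) ^ 32) : |a * Real.exp E - t| < ε := by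
  have hl : (1 + lo / 32) ^ 32 ≤ Real.exp E := by
    calc (1 + lo / 32) ^ 32 ≤ Real.exp (lo / 32) ^ 32 :=
          pow_le_pow_left₀ hlo0 (by linarith [Real.add_one_le_exp (lo / 32)]) 32
      _ = Real.exp lo := by rw [← Real.exp_nat_mul]; congr 1; push_cast; ring
      _ ≤ _ := Real.exp_le_exp.2 hlo
  have hu : (1 - hi / 32) ^ 32 * Real.exp E ≤ 1 := by
    calc (1 - hi / 32) ^ 32 * Real.exp E ≤ Real.exp (-(hi / 32)) ^ 32 * Real.exp hi := by
          gcongr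
          linarith [Real.add_one_le_exp (-(hi / 32))]
      _ = 1 := by
          rw [← Real.exp_nat_mul, ← Real.exp_add]
          rw [Real.exp_eq_one_iff]
          push_cast
          ring
  have h3 : a * (1 + lo / 32) ^ 32 ≤ a * Real.exp E := by gcongr
  have h4 : a * Real.exp E < t + ε := by
    have h5 := Real.exp_pos E
    have h6 : 0 < (1 - hi / 32) ^ 32 := by positivity
    have hte : 0 < t + ε := by
      by_contra hcon
      nlinarith
    calc a * Real.exp E < (t + ε) * (1 - hi / 32) ^ 32 * Real.exp E := by gcongr
      _ = (t + ε) * ((1 - hi / 32) ^ 32 * Real.exp E) := by ring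
      _ ≤ (t + ε) * 1 := by gcongr
      _ = t + ε := mul_one _
  rw [abs_lt]
  constructor <;> linarith

lemma harmonic_bounds {k : ℕ} (hk : k ≠ 0) :
    Real.log k + 1 / 2 < harmonic k ∧ (harmonic k : ℝ) < Real.log ((k : ℝ) + 1) + 2 / 3 := by
  have h1 := Real.eulerMascheroniSeq_lt_eulerMascheroniConstant k
  have h2 := Real.eulerMascheroniConstant_lt_eulerMascheroniSeq' k
  rw [Real.eulerMascheroniSeq] at h1
  rw [Real.eulerMascheroniSeq', if_neg hk] at h2
  have h3 := Real.one_half_lt_eulerMascheroniConstant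
  have h4 := Real.eulerMascheroniConstant_lt_two_thirds
  constructor <;> linarith

lemma shannonConst_hundred : |shannonConst 100 - 0.936| < 0.0005 := by
  obtain ⟨ε, h0, h1, h2⟩ := shannonConst_even 49
  norm_num at h1 h2
  have hl1 := Real.log_two_gt_d9
  have hl2 := Real.log_two_lt_d9
  have hH : ((harmonic 49 : ℚ) : ℝ) < 4.4793 ∧ 4.4792 < ((harmonic 49 : ℚ) : ℝ) := by
    norm_num [harmonic, Finset.sum_range_succ]
  rw [h2]
  refine abs_mul_exp_sub_lt (lo := -0.0563) (hi := -0.0560) (by norm_num) ?_ ?_ (by norm_num)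
    (by norm_num) (by norm_num) (by norm_num)
  · rw [le_div_iff₀ (by norm_num)]
    linarith
  · rw [div_le_iff₀ (by norm_num)]
    linarith

lemma shannonConst_thousand : |shannonConst 1000 - 0.991| < 0.0005 := by
  obtain ⟨ε, h0, h1, h2⟩ := shannonConst_even 499
  rw [show ((499 : ℕ) : ℝ) = 499 by norm_num] at h1 h2
  rw [show 2 * (499 + 1) = 1000 by norm_num] at h2
  norm_num only at h1
  have hl1 := Real.log_two_gt_d9
  have hl2 := Real.log_two_lt_d9
  have hf1 := Real.log_five_gt_d9
  have hf2 := Real.log_five_lt_d9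
  obtain ⟨hH1, hH2⟩ := harmonic_bounds (k := 499) (by norm_num)
  rw [show ((499 : ℕ) : ℝ) = 499 by norm_num] at hH1
  rw [show ((499 : ℕ) : ℝ) + 1 = 500 by norm_num] at hH2
  have hlog : Real.log 500 = 2 * Real.log 2 + 3 * Real.log 5 := by
    rw [show (500 : ℝ) = 2 ^ 2 * 5 ^ 3 by norm_num, Real.log_mul (by norm_num) (by norm_num),
      Real.log_pow, Real.log_pow]
    norm_num
  have hlog' : Real.log 500 - 1 / 499 ≤ Real.log 499 := by
    have h := Real.log_le_sub_one_of_pos (show (0 : ℝ) < 500 / 499 by norm_num)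
    rw [Real.log_div (by norm_num) (by norm_num)] at h
    linarith
  rw [h2]
  refine abs_mul_exp_sub_lt (lo := -0.0081) (hi := -0.0077) (by norm_num) ?_ ?_ (by norm_num)
    (by norm_num) (by norm_num) (by norm_num)
  · rw [le_div_iff₀ (by norm_num)]
    linarith
  · rw [div_le_iff₀ (by norm_num)]
    linarith

lemma shannonConst_ten_thousand : |shannonConst 10000 - 0.999| < 0.0005 := by
  obtain ⟨ε, h0, h1, h2⟩ := shannonConst_even 4999
  rw [show ((4999 : ℕ) : ℝ) = 4999 by norm_num] at h1 h2
  rw [show 2 * (4999 + 1) = 10000 by norm_num] at h2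
  norm_num only at h1
  have hl1 := Real.log_two_gt_d9
  have hl2 := Real.log_two_lt_d9
  have hf1 := Real.log_five_gt_d9
  have hf2 := Real.log_five_lt_d9
  obtain ⟨hH1, hH2⟩ := harmonic_bounds (k := 4999) (by norm_num)
  rw [show ((4999 : ℕ) : ℝ) = 4999 by norm_num] at hH1
  rw [show ((4999 : ℕ) : ℝ) + 1 = 5000 by norm_num] at hH2
  have hlog : Real.log 5000 = 3 * Real.log 2 + 4 * Real.log 5 := by
    rw [show (5000 : ℝ) = 2 ^ 3 * 5 ^ 4 by norm_num, Real.log_mul (by norm_num) (by norm_num),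
      Real.log_pow, Real.log_pow]
    norm_num
  have hlog' : Real.log 5000 - 1 / 4999 ≤ Real.log 4999 := by
    have h := Real.log_le_sub_one_of_pos (show (0 : ℝ) < 5000 / 4999 by norm_num)
    rw [Real.log_div (by norm_num) (by norm_num)] at h
    linarith
  rw [h2]
  refine abs_mul_exp_sub_lt (lo := -0.0012) (hi := -0.0009) (by norm_num) ?_ ?_ (by norm_num)
    (by norm_num) (by norm_num) (by norm_num)
  · rw [le_div_iff₀ (by norm_num)]
    linarith
  · rw [div_le_iff₀ (by norm_num)]
    linarith

theorem theorem5p1 :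
    (∀ (d : ℕ), 2 ≤ d →
      ∀ (b : ℝ), 0 ≤ b →
      -- the total number of bits `N = b * d`, a natural number
      ∀ (N : ℕ), (N : ℝ) = b * (d : ℝ) →
      -- the quantization map and the dequantization map
      ∀ (Q : EuclideanSpace ℝ (Fin d) → (Fin N → Bool)), Measurable Q →
      ∀ (Qinv : (Fin N → Bool) → EuclideanSpace ℝ (Fin d)),
      ∀ {Ω : Type*} [MeasurableSpace Ω] (P : Measure Ω) [IsProbabilityMeasure P]
        (X : Ω → EuclideanSpace ℝ (Fin d)), HasLaw X (sphereUniform d) P →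
        Integrable (fun ω => ‖X ω - Qinv (Q (X ω))‖ ^ 2) P ∧
        shannonConst d * (1 / 4 : ℝ) ^ (b * (d : ℝ) / ((d : ℝ) - 1)) ≤
          ∫ ω, ‖X ω - Qinv (Q (X ω))‖ ^ 2 ∂P) ∧
    Tendsto shannonConst atTop (𝓝 1) ∧
    |shannonConst 100 - 0.936| < 0.0005 ∧
    |shannonConst 1000 - 0.991| < 0.0005 ∧
    |shannonConst 10000 - 0.999| < 0.0005 := by
  refine ⟨?_, tendsto_shannonConst, shannonConst_hundred, shannonConst_thousand,
    shannonConst_ten_thousand⟩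
  intro d hd b _ N hN Q hQ Qinv Ω _ P _ X hX
  obtain ⟨n, rfl⟩ : ∃ n, d = n + 1 := ⟨d - 1, by omega⟩
  have hint := integrable_quantization_error hQ Qinv
  constructor
  · have h := hX.map_eq ▸ hint
    exact h.comp_aemeasurable hX.aemeasurable
  · have hcomp : ∫ ω, ‖X ω - Qinv (Q (X ω))‖ ^ 2 ∂P =
        ∫ x, ‖x - Qinv (Q x)‖ ^ 2 ∂(sphereUniform (n + 1)) :=
      hX.integral_comp hint.aestronglyMeasurable
    rw [hcomp, ← hN, show (((n + 1 : ℕ) : ℝ) - 1) = n by push_cast; ring,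
      shannonConst_mul_eq (by omega) N]
    have h := shannon_lower_bound_sphere (by omega) Qinv Q hint
    simpa using h
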